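/- Let $\mathbb N$ be the set of natural numbers, $\mathcal O^{(n)}=\mathbb N^{\mathbb N^n}$ ($n\ge 1$) the set of $n$-ary operations on $\mathbb N$, with the product topology for the discrete topology on $\mathbb N$, and $\mathcal O=\bigcup_{n\ge1}\mathcal O^{(n)}$. A *clone* is a subset of $\mathcal O$ that contains all projections and is closed under composition; it is *local* if for every $n\ge 1$ its set of $n$-ary members is closed in $\mathcal O^{(n)}$. For $\mathcal F\subseteq\mathcal O$ let $\langle\mathcal F\rangle$ be the smallest local clone containing $\mathcal F$. For a set $\mathcal M\subseteq\mathcal O^{(1)}$ let the monoidal interval $I_{\mathcal M}$ be the set of all local clones $\mathcal C$ with $\mathcal C\cap\mathcal O^{(1)}=\mathcal M$, ordered by inclusion. An operation is *essentially unary* if it depends on at most one of its variables. An $n$-ary operation $f$ is *quasilinear* if there are functions $\phi_0:\{0,1\}\to\mathbb N$ and $\phi_1,\dots,\phi_n:\mathbb N\to\{0,1\}$ with $f(x_1,\dots,x_n)=\phi_0(\phi_1(x_1)+\dots+\phi_n(x_n))$ for all $x_1,\dots,x_n$, where the sum is taken modulo $2$. **Theorem.** Let $\mathcal M\subseteq\mathcal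 O^{(1)}$ be a monoid of transformations of $\mathbb N$ which is closed in $\mathcal O^{(1)}$ and contains all permutations of $\mathbb N$ as well as an operation that is neither constant nor injective. 1. If $\mathcal M=\mathcal O^{(1)}$, then $I_{\mathcal M}$ is a chain of order type $\omega+1$ with largest element $\mathcal O$. Its smallest element is $\langle\mathcal O^{(1)}\rangle$, which is the clone of all essentially unary operations. Its second smallest element is Burle's clone $\mathcal Q$ of all operations which are essentially unary or quasilinear. For every $n\ge 3$, its $n$-th smallest element is the clone $\mathcal K_n$ of all operations which are essentially unary or whose range has less than $n$ elements. 2. If $\mathcal M\ne\mathcal O^{(1)}$, then there is a largest natural number $k$ such that $\mathcal M$ contains all unary operations which take at most $k$ values, and $k\ge 1$. If $k=1$, then $I_{\mathcal M}=\{\langle\mathcal M\rangle\}$. If $k\geq 2$, then $I_{\mathcal M}$ is a finite chain with exactly $k+1$ elements: its smallest element is $\langle\mathcal M\rangle$; its second smallest element $\mathcal Q^{\mathcal M}$ consists of $\langle\mathcal M\rangle$ and all quasilinear operations; and for $3\le n\le k+1$ its $n$-th smallest element $\mathcal K^{\mathcal M}_n$ consists of $\langle\mathcal M\rangle$ and all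 operations whose range has less than $n$ elements. -/

import Mathlib

/-- The `n`-ary operations on `ℕ`. Being a product of copies of the discrete space `ℕ`, this type
carries the product topology (the topology of pointwise convergence). -/
abbrev Op (n : ℕ) : Type := (Fin n → ℕ) → ℕ

/-- All operations on `ℕ` of finite positive arity (each one together with its arity). -/
abbrev Operation : Type := Σ n : ℕ+, Op n

/-- A transformation of `ℕ`, regarded as a unary operation. -/
def ofUnary (h : ℕ → ℕ) : Op 1 := fun x => h (x 0)

/-- A transformation of `ℕ`, regarded as an element of the set of all operations. -/
def unaryOperation (h : ℕ → ℕ) : Operation := ⟨1, ofUnary h⟩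

/-- A clone: a set of operations containing all projections and closed under composition. -/
structure IsClone (C : Set Operation) : Prop where
  proj_mem : ∀ (n : ℕ+) (i : Fin n), (⟨n, fun x => x i⟩ : Operation) ∈ C
  comp_mem : ∀ (n m : ℕ+) (f : Op n) (g : Fin n → Op m),
    (⟨n, f⟩ : Operation) ∈ C → (∀ i, (⟨m, g i⟩ : Operation) ∈ C) →
      (⟨m, fun x => f (fun i => g i x)⟩ : Operation) ∈ C

/-- A local clone: a clone each of whose `n`-ary fragments is topologically closed. -/
structure IsLocalClone (C : Set Operation) : Prop extends IsClone C where
  isClosed : ∀ n : ℕ+, IsClosed {f : Op n | (⟨n, f⟩ : Operation) ∈ C}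

/-- The smallest local clone containing a given set of operations. -/
def localCloneClosure (F : Set Operation) : Set Operation :=
  ⋂₀ {C : Set Operation | IsLocalClone C ∧ F ⊆ C}

/-- A locally closed monoid of transformations of `ℕ`. -/
structure IsLocalMonoid (M : Set (ℕ → ℕ)) : Prop where
  id_mem : id ∈ M
  comp_mem : ∀ f ∈ M, ∀ g ∈ M, f ∘ g ∈ M
  isClosed : IsClosed M

/-- `⟨M⟩`: the smallest local clone containing the set `M` of unary operations. -/
def cloneOf (M : Set (ℕ → ℕ)) : Set Operation :=
  localCloneClosure (unaryOperation '' M)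

/-- The monoidal interval of `M`: all local clones whose unary fragment is `M`. It is ordered by
inclusion. -/
def monoidalInterval (M : Set (ℕ → ℕ)) : Set (Set Operation) :=
  {C | IsLocalClone C ∧ {h : ℕ → ℕ | unaryOperation h ∈ C} = M}

/-- `f` depends on its `i`-th variable. -/
def DependsOnVar {n : ℕ} (f : Op n) (i : Fin n) : Prop :=
  ∃ (x : Fin n → ℕ) (a : ℕ), f (Function.update x i a) ≠ f x

/-- An operation is essentially unary if it does not depend on two distinct variables
(so constant operations are essentially unary). -/
def EssentiallyUnary {n : ℕ} (f : Op n) : Prop :=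
  ¬ ∃ i j : Fin n, i ≠ j ∧ DependsOnVar f i ∧ DependsOnVar f j

/-- `f` is quasilinear: `f(x₁,…,xₙ) = φ₀(φ₁(x₁) + ⋯ + φₙ(xₙ))` with addition modulo `2`. -/
def Quasilinear {n : ℕ} (f : Op n) : Prop :=
  ∃ (φ₀ : ZMod 2 → ℕ) (φ : Fin n → ℕ → ZMod 2), ∀ x, f x = φ₀ (∑ i, φ i (x i))

/-- The set of all essentially unary operations. -/
def essentiallyUnaryOperations : Set Operation := {f | EssentiallyUnary f.2}

/-- The set of all quasilinear operations. -/
def quasilinearOperations : Set Operation := {f | Quasilinear f.2}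

/-- The set of all operations whose range has less than `n` elements. -/
def rangeLtOperations (n : ℕ) : Set Operation := {f | (Set.range f.2).encard < n}

/-- Burle's clone `𝒬`. -/
def burleClone : Set Operation := essentiallyUnaryOperations ∪ quasilinearOperations

/-- The clone `𝒦ₙ`. -/
def rangeClone (n : ℕ) : Set Operation := essentiallyUnaryOperations ∪ rangeLtOperations n

/-- The clone `𝒬^M`. -/
def burleCloneOver (M : Set (ℕ → ℕ)) : Set Operation := cloneOf M ∪ quasilinearOperations

/-- The clone `𝒦ₙ^M`. -/
def rangeCloneOver (M : Set (ℕ → ℕ)) (n : ℕ) : Set Operation := cloneOf M ∪ rangeLtOperations n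

/-- `M` contains all transformations of `ℕ` which take at most `k` values. -/
def ContainsRangeLe (M : Set (ℕ → ℕ)) (k : ℕ) : Prop :=
  ∀ h : ℕ → ℕ, (Set.range h).encard ≤ k → h ∈ M

/-! Let `C` be a clone in the interval. Its essentially unary members are exactly `⟨M⟩`.
Permutations, a noninjective nonconstant map and local closure put all constants and all point
indicators into `M`, so the `{0, 1}`-valued members of `C` can be negated and their two values
relabelled at will.

Suppose `C` has a member `f` that is not essentially unary. If on some `2 × 2` square one value of
`f` differs from the other three, `f` yields conjunction, and interpolation on finite sets gives all
two-valued operations (`mem_of_isolatedCorner`). If there is no such square, `f` is quasilinear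
(`quasilinear_of_no_isolatedCorner`) and yields addition modulo `2`, hence all quasilinear
operations.

If `f` is neither essentially unary nor quasilinear, larger ranges follow by induction: three tuples
with distinct `f`-values, the first agreeing in each coordinate with one of the others, let `f`
build an operation with `k + 1` values from operations with at most `k` (`mem_of_three_values`). So
`C` is determined by the range sizes of such `f`; if these are unbounded, local closure gives all
operations. Which cases occur depends on the finite-range maps in `M`. -/

/-! ### Closed sets of functions and finite interpolation -/

theorem IsClosed.mem_of_forall_finset {X : Type*} {S : Set (X → ℕ)} (hS : IsClosed S) {f : X → ℕ}
    (h : ∀ A : Finset X, ∃ g ∈ S, ∀ x ∈ A, g x = f x) : f ∈ S := by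
  rw [← hS.closure_eq, mem_closure_iff]
  intro o ho hf
  obtain ⟨A, u, hu, hA⟩ := isOpen_pi_iff.1 ho f hf
  obtain ⟨g, hg, hgA⟩ := h A
  exact ⟨g, hA fun x hx => by rw [hgA x hx]; exact (hu x hx).2, hg⟩

theorem isClosed_of_forall_finset {X : Type*} {S : Set (X → ℕ)}
    (h : ∀ f, (∀ A : Finset X, ∃ g ∈ S, ∀ x ∈ A, g x = f x) → f ∈ S) : IsClosed S := by
  rw [← isOpen_compl_iff, isOpen_pi_iff]
  intro f hf
  by_contra hcon
  push Not at hcon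
  refine hf (h f fun A => ?_)
  have := hcon A (fun x => {f x}) (fun x _ => ⟨isOpen_discrete _, rfl⟩)
  obtain ⟨g, hg, hgS⟩ := Set.not_subset.1 this
  exact ⟨g, not_not.1 hgS, fun x hx => hg x hx⟩

/-! ### Permutations with prescribed finite behaviour -/

theorem exists_perm_extending {A : Finset ℕ} {g : ℕ → ℕ} (hg : Set.InjOn g A) :
    ∃ σ : Equiv.Perm ℕ, ∀ x ∈ A, σ x = g x := by
  obtain ⟨σ, hσ⟩ := Cardinal.extend_function_of_lt (s := (A : Set ℕ)) (β := ℕ)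
    ⟨fun x => g x, fun x y h => Subtype.ext (hg x.2 y.2 h)⟩
    (by simp) ⟨Equiv.refl ℕ⟩
  exact ⟨σ, fun x hx => hσ ⟨x, hx⟩⟩

theorem exists_perm_image_eq {A B : Finset ℕ} (h : A.card = B.card) :
    ∃ σ : Equiv.Perm ℕ, A.image σ = B := by
  obtain ⟨g, hg⟩ := Set.Finite.exists_bijOn_of_encard_eq (s := (A : Set ℕ)) (t := (B : Set ℕ))
    A.finite_toSet (by simp [h])
  obtain ⟨σ, hσ⟩ := exists_perm_extending hg.injOn
  refine ⟨σ, Finset.coe_injective ?_⟩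
  rw [Finset.coe_image, ← hg.image_eq]
  exact Set.image_congr hσ

theorem exists_perm_image_eq_apply_eq {A B : Finset ℕ} (h : A.card = B.card) {p q : ℕ}
    (hp : p ∉ A) (hq : q ∉ B) : ∃ σ : Equiv.Perm ℕ, A.image σ = B ∧ σ p = q := by
  obtain ⟨σ, hσ⟩ := exists_perm_image_eq h
  have hσp : σ p ∉ B := by
    rw [← hσ]
    simpa using hp
  -- Both `σ p` and `q` lie outside `B`, so the transposition fixes `B` pointwise.
  refine ⟨σ.trans (Equiv.swap (σ p) q), ?_, by simp⟩
  rw [Equiv.coe_trans, ← Finset.image_image, hσ]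
  ext b
  rw [Finset.mem_image]
  constructor
  · rintro ⟨a, ha, rfl⟩
    rwa [Equiv.swap_apply_of_ne_of_ne (ne_of_mem_of_not_mem ha hσp)
      (ne_of_mem_of_not_mem ha hq)]
  · intro hb
    exact ⟨b, hb, Equiv.swap_apply_of_ne_of_ne (ne_of_mem_of_not_mem hb hσp)
      (ne_of_mem_of_not_mem hb hq)⟩

/-! ### Constants and point indicators in the monoid -/

/-- The function `ℕ → {0, 1}` singling out the point `p`. -/
def pointIndicator (p : ℕ) (x : ℕ) : ℕ := if x = p then 1 else 0

/-- The infinite complement of the fibre of `c` leaves room to move any finite set into it so that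
it covers `a` and `b`. -/
theorem exists_mem_merging_pair {M : Set (ℕ → ℕ)}
    (hlarge : ∃ f ∈ M, (¬ ∃ c, ∀ x, f x = c) ∧ ¬ Function.Injective f) :
    ∃ h ∈ M, ∃ a b c, a ≠ b ∧ h a = h b ∧ h a ≠ h c ∧ {x | h x ≠ h c}.Infinite := by
  obtain ⟨h, hM, hconst, hinj⟩ := hlarge
  simp only [Function.Injective, not_forall] at hinj
  obtain ⟨a, b, hab, hne⟩ := hinj
  obtain ⟨c, hc⟩ : ∃ c, h a ≠ h c := by
    by_contra! hcon
    exact hconst ⟨h a, fun x => (hcon x).symm⟩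
  by_cases hinf : {x | h x ≠ h c}.Infinite
  · exact ⟨h, hM, a, b, c, hne, hab, hc, hinf⟩
  -- Now the fibre of `c` is infinite: it supplies the merged pair, and `a` becomes the separated
  -- point.
  · have hinf' : {x | h x = h c}.Infinite := by
      intro hfin
      apply Set.infinite_univ (α := ℕ)
      refine (hfin.union (Set.not_infinite.1 hinf)).subset fun x _ => ?_
      exact em (h x = h c)
    obtain ⟨a', ha', b', hb', hne'⟩ := hinf'.nontrivial
    refine ⟨h, hM, a', b', a, hne', ha'.trans hb'.symm, fun e => hc (e.symm.trans ha'),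
      hinf'.mono fun x hx e => hc ?_⟩
    exact e.symm.trans hx

/-- Induction on the size of `A`: a permutation moves `A` onto a set containing the merged pair and
`p` to `c`; then `h` shrinks the set and keeps `h c` outside its image. -/
theorem exists_mem_collapsing {M : Set (ℕ → ℕ)} (hM : IsLocalMonoid M)
    (hperm : ∀ σ : Equiv.Perm ℕ, (⇑σ : ℕ → ℕ) ∈ M)
    (hlarge : ∃ f ∈ M, (¬ ∃ c, ∀ x, f x = c) ∧ ¬ Function.Injective f)
    (A : Finset ℕ) (p : ℕ) (hp : p ∉ A) :
    ∃ u ∈ M, (∀ x ∈ A, ∀ y ∈ A, u x = u y) ∧ ∀ x ∈ A, u x ≠ u p := by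
  obtain ⟨h, hhM, a, b, c, hab, hhab, hac, hinf⟩ := exists_mem_merging_pair hlarge
  induction hn : A.card using Nat.strong_induction_on generalizing A p with
  | _ n ih =>
    subst hn
    by_cases hA : A.card ≤ 1
    · exact ⟨id, hM.id_mem, fun x hx y hy => Finset.card_le_one.1 hA x hx y hy,
        fun x hx => ne_of_mem_of_not_mem hx hp⟩
    · obtain ⟨B, hB, hBW, hBc⟩ : ∃ B : Finset ℕ, {a, b} ⊆ B ∧ (B : Set ℕ) ⊆ {x | h x ≠ h c} ∧
          B.card = A.card := by
        obtain ⟨T, h1, h2, h3⟩ := Set.exists_superset_subset_encard_eq (s := ({a, b} : Set ℕ))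
          (t := {x | h x ≠ h c}) (k := A.card) (by
            rintro x (rfl | rfl)
            · exact hac
            · exact fun e => hac (hhab.trans e)) (by
            rw [Set.encard_pair hab]
            exact_mod_cast (not_le.1 hA)) (by simp [hinf.encard_eq])
        have hfin := Set.finite_of_encard_eq_coe h3
        refine ⟨hfin.toFinset, by intro x; simpa using @h1 x, by simpa using h2, ?_⟩
        rw [hfin.encard_eq_coe_toFinset_card] at h3
        exact_mod_cast h3
      obtain ⟨τ, hτ, hτp⟩ := exists_perm_image_eq_apply_eq hBc.symm hp (q := c)
        (fun hc => hBW hc rfl)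
      have hlt : (A.image (h ∘ τ)).card < A.card := by
        rw [← Finset.image_image, hτ, ← hBc]
        refine lt_of_le_of_ne Finset.card_image_le fun e => hab ?_
        exact Finset.card_image_iff.1 e (hB (by simp)) (hB (by simp)) hhab
      have hmem : ∀ x ∈ A, τ x ∈ B := fun x hx => hτ ▸ Finset.mem_image_of_mem _ hx
      obtain ⟨u, huM, hu1, hu2⟩ := ih _ hlt (A.image (h ∘ τ)) (h c) (by
        intro hcon
        obtain ⟨x, hx, e⟩ := Finset.mem_image.1 hcon
        exact hBW (hmem x hx) e) rfl
      refine ⟨u ∘ (h ∘ τ), hM.comp_mem _ huM _ (hM.comp_mem _ hhM _ (hperm τ)), ?_, ?_⟩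
      · intro x hx y hy
        exact hu1 _ (Finset.mem_image_of_mem _ hx) _ (Finset.mem_image_of_mem _ hy)
      · intro x hx
        have := hu2 _ (Finset.mem_image_of_mem (h ∘ τ) hx)
        simpa [hτp] using this

theorem const_mem {M : Set (ℕ → ℕ)} (hM : IsLocalMonoid M)
    (hperm : ∀ σ : Equiv.Perm ℕ, (⇑σ : ℕ → ℕ) ∈ M)
    (hlarge : ∃ f ∈ M, (¬ ∃ c, ∀ x, f x = c) ∧ ¬ Function.Injective f)
    (c : ℕ) : (fun _ => c) ∈ M := by
  refine hM.isClosed.mem_of_forall_finset fun A => ?_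
  obtain ⟨p, hp⟩ := Infinite.exists_notMem_finset A
  obtain ⟨u, huM, hu, -⟩ := exists_mem_collapsing hM hperm hlarge A p hp
  obtain rfl | ⟨a, ha⟩ := A.eq_empty_or_nonempty
  · exact ⟨id, hM.id_mem, by simp⟩
  · exact ⟨Equiv.swap (u a) c ∘ u, hM.comp_mem _ (hperm _) _ huM, fun x hx => by
      simp [hu x hx a ha]⟩

/-- On a finite set, collapse everything except `p` to one value and permute the two resulting
values to `0` and `1`. -/
theorem pointIndicator_mem {M : Set (ℕ → ℕ)} (hM : IsLocalMonoid M)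
    (hperm : ∀ σ : Equiv.Perm ℕ, (⇑σ : ℕ → ℕ) ∈ M)
    (hlarge : ∃ f ∈ M, (¬ ∃ c, ∀ x, f x = c) ∧ ¬ Function.Injective f)
    (p : ℕ) : pointIndicator p ∈ M := by
  refine hM.isClosed.mem_of_forall_finset fun A => ?_
  obtain ⟨u, huM, hu, hup⟩ :=
    exists_mem_collapsing hM hperm hlarge (A.erase p) p (Finset.notMem_erase p A)
  obtain h | ⟨a, ha⟩ := (A.erase p).eq_empty_or_nonempty
  · refine ⟨_, const_mem hM hperm hlarge 1, fun x hx => ?_⟩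
    have : x = p := by
      by_contra hne
      have : x ∈ A.erase p := Finset.mem_erase.2 ⟨hne, hx⟩
      simp [h] at this
    simp [pointIndicator, this]
  · obtain ⟨σ, hσ⟩ := exists_perm_extending (A := {u p, u a})
      (g := fun x => if x = u p then 1 else 0) (by
        intro x hx y hy
        have := hup a ha
        simp only [Finset.coe_insert, Finset.coe_singleton, Set.mem_insert_iff,
          Set.mem_singleton_iff] at hx hy
        rcases hx with rfl | rfl <;> rcases hy with rfl | rfl <;> simp [this])
    refine ⟨σ ∘ u, hM.comp_mem _ (hperm _) _ huM, fun x hx => ?_⟩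
    by_cases hxp : x = p
    · subst hxp
      simp [pointIndicator, hσ]
    · have hxa : u x = u a := hu x (Finset.mem_erase.2 ⟨hxp, hx⟩) a ha
      simp [pointIndicator, hxp, hxa, hσ, hup a ha]

/-! ### Predicates in a rich clone -/

theorem IsClone.unary_comp_mem {C : Set Operation} (hC : IsClone C) {N : ℕ+} {u : ℕ → ℕ} {s : Op N}
    (hu : unaryOperation u ∈ C) (hs : (⟨N, s⟩ : Operation) ∈ C) :
    (⟨N, fun x => u (s x)⟩ : Operation) ∈ C :=
  hC.comp_mem 1 N (ofUnary u) (fun _ => s) hu fun _ => hs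

/-- A local clone containing the permutations, the constants and the point indicators. -/
structure IsRichClone (C : Set Operation) : Prop extends IsLocalClone C where
  perm_mem : ∀ σ : Equiv.Perm ℕ, unaryOperation σ ∈ C
  const_mem : ∀ c : ℕ, unaryOperation (fun _ => c) ∈ C
  pointIndicator_mem : ∀ p : ℕ, unaryOperation (pointIndicator p) ∈ C

/-- The `{0, 1}`-valued operation given by `F` belongs to `C`. -/
def HasPredicate (C : Set Operation) {N : ℕ+} (F : (Fin N → ℕ) → ZMod 2) : Prop :=
  (⟨N, fun x => (F x).val⟩ : Operation) ∈ C

namespace IsRichClone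

variable {C : Set Operation}

theorem exists_unary_pair (hC : IsRichClone C) (a b : ℕ) :
    ∃ u, unaryOperation u ∈ C ∧ u 0 = a ∧ u 1 = b := by
  by_cases hab : a = b
  · exact ⟨fun _ => a, hC.const_mem a, rfl, hab⟩
  · obtain ⟨σ, hσ⟩ := exists_perm_extending (A := {0, 1}) (g := fun x => if x = 0 then a else b) (by
      intro x hx y hy
      simp only [Finset.coe_insert, Finset.coe_singleton, Set.mem_insert_iff,
        Set.mem_singleton_iff] at hx hy
      rcases hx with rfl | rfl <;> rcases hy with rfl | rfl <;> simp [hab, Ne.symm hab])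
    exact ⟨σ, hC.perm_mem σ, by simp [hσ], by simp [hσ]⟩

theorem mem_of_predicate (hC : IsRichClone C) {N : ℕ+} {F : (Fin N → ℕ) → ZMod 2}
    (hF : HasPredicate C F) (φ : ZMod 2 → ℕ) : (⟨N, fun x => φ (F x)⟩ : Operation) ∈ C := by
  obtain ⟨u, hu, h0, h1⟩ := hC.exists_unary_pair (φ 0) (φ 1)
  have hφ : ∀ z : ZMod 2, u z.val = φ z := by
    intro z
    fin_cases z
    · exact h0
    · exact h1
  have := hC.unary_comp_mem hu hF
  simpa only [hφ] using this

theorem hasPredicate_of_forall_finset (hC : IsRichClone C) {N : ℕ+} {F : (Fin N → ℕ) → ZMod 2}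
    (h : ∀ A : Finset (Fin N → ℕ), ∃ G, HasPredicate C G ∧ ∀ x ∈ A, G x = F x) :
    HasPredicate C F := by
  refine (hC.isClosed N).mem_of_forall_finset fun A => ?_
  obtain ⟨G, hG, hGA⟩ := h A
  exact ⟨_, hG, fun x hx => by rw [hGA x hx]⟩

theorem const_op_mem (hC : IsRichClone C) (N : ℕ+) (c : ℕ) :
    (⟨N, fun _ => c⟩ : Operation) ∈ C :=
  hC.unary_comp_mem (hC.const_mem c) (hC.proj_mem N ⟨0, N.pos⟩)

theorem hasPredicate_const (hC : IsRichClone C) (N : ℕ+) (c : ZMod 2) :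
    HasPredicate C (fun _ : Fin N → ℕ => c) :=
  hC.const_op_mem N c.val

theorem hasPredicate_eq (hC : IsRichClone C) {N : ℕ+} (i : Fin N) (a : ℕ) :
    HasPredicate C (fun x : Fin N → ℕ => if x i = a then 1 else 0) := by
  have := hC.unary_comp_mem (hC.pointIndicator_mem a) (hC.proj_mem N i)
  unfold HasPredicate
  convert this using 3
  simp only [pointIndicator]
  split_ifs <;> rfl

/-- Negation is the indicator of `0`. -/
theorem hasPredicate_one_add (hC : IsRichClone C) {N : ℕ+} {F : (Fin N → ℕ) → ZMod 2}
    (hF : HasPredicate C F) : HasPredicate C (fun x => 1 + F x) := by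
  have := hC.unary_comp_mem (hC.pointIndicator_mem 0) hF
  unfold HasPredicate
  convert this using 3 with x
  have h : ∀ z : ZMod 2, (1 + z).val = pointIndicator 0 z.val := by decide
  exact h _

theorem hasPredicate_sum (hC : IsRichClone C) {N : ℕ+}
    (hadd : ∀ F G : (Fin N → ℕ) → ZMod 2, HasPredicate C F → HasPredicate C G →
      HasPredicate C (fun x => F x + G x)) {ι : Type*} (s : Finset ι)
    (F : ι → (Fin N → ℕ) → ZMod 2) (hF : ∀ i ∈ s, HasPredicate C (F i)) :
    HasPredicate C (fun x => ∑ i ∈ s, F i x) := by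
  classical
  induction s using Finset.induction_on with
  | empty => simpa using hC.hasPredicate_const N 0
  | insert a s ha ih =>
    simp only [Finset.sum_insert ha]
    exact hadd _ _ (hF a (by simp)) (ih fun i hi => hF i (by simp [hi]))

theorem hasPredicate_prod (hC : IsRichClone C) {N : ℕ+}
    (hmul : ∀ F G : (Fin N → ℕ) → ZMod 2, HasPredicate C F → HasPredicate C G →
      HasPredicate C (fun x => F x * G x)) {ι : Type*} (s : Finset ι)
    (F : ι → (Fin N → ℕ) → ZMod 2) (hF : ∀ i ∈ s, HasPredicate C (F i)) :
    HasPredicate C (fun x => ∏ i ∈ s, F i x) := by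
  classical
  induction s using Finset.induction_on with
  | empty => simpa using hC.hasPredicate_const N 1
  | insert a s ha ih =>
    simp only [Finset.prod_insert ha]
    exact hmul _ _ (hF a (by simp)) (ih fun i hi => hF i (by simp [hi]))

/-- If the predicates of `C` are closed under addition, `C` contains all quasilinear operations. -/
theorem quasilinear_mem_of_add (hC : IsRichClone C) {N : ℕ+}
    (hadd : ∀ F G : (Fin N → ℕ) → ZMod 2, HasPredicate C F → HasPredicate C G →
      HasPredicate C (fun x => F x + G x)) {f : Op N} (hf : Quasilinear f) :
    (⟨N, f⟩ : Operation) ∈ C := by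
  classical
  obtain ⟨φ₀, φ, hφ⟩ := hf
  obtain rfl : f = fun x => φ₀ (∑ i, φ i (x i)) := funext hφ
  refine hC.mem_of_predicate (hC.hasPredicate_of_forall_finset fun A => ?_) φ₀
  -- On `A` each `φ i` is a finite sum of point indicators.
  refine ⟨fun x => ∑ i, ∑ a ∈ A.image (fun x => x i), φ i a * if x i = a then 1 else 0, ?_, ?_⟩
  · refine hC.hasPredicate_sum hadd _ _ fun i _ => hC.hasPredicate_sum hadd _ _ fun a _ => ?_
    have h01 : ∀ z : ZMod 2, z = 0 ∨ z = 1 := by decide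
    rcases h01 (φ i a) with h | h
    · simpa [h] using hC.hasPredicate_const N 0
    · simpa [h] using hC.hasPredicate_eq i a
  · intro x hx
    refine Finset.sum_congr rfl fun i _ => ?_
    have hxi : x i ∈ A.image (fun x => x i) := Finset.mem_image_of_mem _ hx
    simp [hxi]

/-- If the predicates of `C` are closed under multiplication, `C` contains all operations
taking at most two values. -/
theorem mem_of_mul (hC : IsRichClone C) {N : ℕ+}
    (hmul : ∀ F G : (Fin N → ℕ) → ZMod 2, HasPredicate C F → HasPredicate C G →
      HasPredicate C (fun x => F x * G x)) {f : Op N} (hf : (Set.range f).encard ≤ 2) :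
    (⟨N, f⟩ : Operation) ∈ C := by
  classical
  obtain ⟨a, b, hab⟩ : ∃ a b, ∀ x, f x = a ∨ f x = b := by
    by_cases hc : ∀ x, f x = f 0
    · exact ⟨f 0, f 0, fun x => Or.inl (hc x)⟩
    · push Not at hc
      obtain ⟨y, hy⟩ := hc
      refine ⟨f 0, f y, fun x => ?_⟩
      by_contra! hx
      have h3 : ({f x, f 0, f y} : Set ℕ).encard = 3 :=
        Set.encard_eq_three.2 ⟨_, _, _, hx.1, hx.2, hy.symm, rfl⟩
      have hle : ({f x, f 0, f y} : Set ℕ).encard ≤ 2 :=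
        (Set.encard_le_encard (by rintro z (rfl | rfl | rfl) <;> simp)).trans hf
      rw [h3] at hle
      exact absurd hle (by decide)
  have hadd : ∀ F G : (Fin N → ℕ) → ZMod 2, HasPredicate C F → HasPredicate C G →
      HasPredicate C (fun x => F x + G x) := by
    intro F G hF hG
    -- Exclusive or, written with conjunction and negation only.
    have h : ∀ x y : ZMod 2, x + y = 1 + (1 + x * (1 + y)) * (1 + y * (1 + x)) := by decide
    simp only [h (F _)]
    exact hC.hasPredicate_one_add (hmul _ _
      (hC.hasPredicate_one_add (hmul _ _ hF (hC.hasPredicate_one_add hG)))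
      (hC.hasPredicate_one_add (hmul _ _ hG (hC.hasPredicate_one_add hF))))
  have hF : HasPredicate C (fun x => if f x = a then (0 : ZMod 2) else 1) := by
    refine hC.hasPredicate_of_forall_finset fun A => ?_
    -- Disjunctive normal form over `A`; at most one product is nonzero at a given `x`, so the sum
    -- acts as a disjunction.
    refine ⟨fun x => ∑ y ∈ A, (if f y = a then (0 : ZMod 2) else 1) *
      ∏ i, if x i = y i then 1 else 0, ?_, ?_⟩
    · exact hC.hasPredicate_sum hadd _ _ fun y _ => hmul _ _ (hC.hasPredicate_const N _)
        (hC.hasPredicate_prod hmul _ _ fun i _ => hC.hasPredicate_eq i (y i))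
    · intro x hx
      have hprod : ∀ y : Fin N → ℕ,
          (∏ i, if x i = y i then (1 : ZMod 2) else 0) = if x = y then 1 else 0 := by
        intro y
        simp [Finset.prod_boole, funext_iff]
      simp [hprod, hx]
  convert hC.mem_of_predicate hF (fun z => if z = 0 then a else b) using 3 with x
  by_cases hx : f x = a
  · simp [hx]
  · simp [(hab x).resolve_left hx]

/-- Substitution of relabelled predicates into an operation. -/
theorem substitution_mem (hC : IsRichClone C) {n N : ℕ+} {f : Op n} (hf : (⟨n, f⟩ : Operation) ∈ C)
    {F : Fin n → (Fin N → ℕ) → ZMod 2} (hF : ∀ j, HasPredicate C (F j))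
    (u : Fin n → ZMod 2 → ℕ) :
    (⟨N, fun z => f (fun j => u j (F j z))⟩ : Operation) ∈ C :=
  hC.comp_mem n N f _ hf fun j => hC.mem_of_predicate (hF j) (u j)

end IsRichClone

/-! ### Conjunction and addition from a single operation -/

/-- Some value on a `2 × 2` square differs from the other three values on it. -/
def HasIsolatedCorner {X Y : Type*} (F : X → Y → ℕ) : Prop :=
  ∃ x x' y y', F x' y' ≠ F x y ∧ F x' y' ≠ F x' y ∧ F x' y' ≠ F x y'

/-- `f` as a function of its variable `i` and of all its variables (of which the `i`-th one
is ignored). -/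
def splitVar {n : ℕ} (f : Op n) (i : Fin n) (s : ℕ) (y : Fin n → ℕ) : ℕ :=
  f (Function.update y i s)

/-- Let `F` choose the `i`-th coordinate and `G` all others from the two sides of the square; the
indicator of the isolated value then computes `F * G`. -/
theorem IsRichClone.mem_of_isolatedCorner {C : Set Operation} (hC : IsRichClone C) {n N : ℕ+}
    {f : Op n} (hf : (⟨n, f⟩ : Operation) ∈ C) {i : Fin n} (hi : HasIsolatedCorner (splitVar f i))
    {h : Op N} (hh : (Set.range h).encard ≤ 2) : (⟨N, h⟩ : Operation) ∈ C := by
  obtain ⟨s, s', y, y', h1, h2, h3⟩ := hi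
  refine hC.mem_of_mul (fun F G hF hG => ?_) hh
  have hsub := hC.unary_comp_mem (hC.pointIndicator_mem (splitVar f i s' y'))
    (hC.substitution_mem hf (F := fun j => if j = i then F else G)
      (fun j => by by_cases hj : j = i <;> simp [hj, hF, hG])
      (fun j z => if j = i then (if z = 0 then s else s') else if z = 0 then y j else y' j))
  unfold HasPredicate
  convert hsub using 3 with z
  have key : (fun j => (fun j z => if j = i then (if z = 0 then s else s') else
      if z = 0 then y j else y' j) j ((fun j => if j = i then F else G) j z)) =
      Function.update (if G z = 0 then y else y') i (if F z = 0 then s else s') := by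
    funext j
    by_cases hj : j = i
    · subst hj
      simp
    · by_cases hG : G z = 0 <;> simp [hj, hG]
  rw [key]
  change _ = pointIndicator _ (splitVar f i _ _)
  have h01 : ∀ z : ZMod 2, z = 0 ∨ z = 1 := by decide
  rcases h01 (F z) with hF | hF <;> rcases h01 (G z) with hG | hG <;>
    simp [hF, hG, pointIndicator, h1.symm, h2.symm, h3.symm, ZMod.val_one]

theorem exists_ne_of_dependsOnVar {n : ℕ} {φ₀ : ZMod 2 → ℕ} {φ : Fin n → ℕ → ZMod 2} {i : Fin n}
    (h : DependsOnVar (fun x => φ₀ (∑ j, φ j (x j))) i) :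
    φ₀ 0 ≠ φ₀ 1 ∧ ∃ a b, φ i b = φ i a + 1 := by
  obtain ⟨x, a, hxa⟩ := h
  have h01 : ∀ z : ZMod 2, z = 0 ∨ z = 1 := by decide
  have hne : ∀ z w : ZMod 2, z ≠ w → w = z + 1 := by decide
  constructor
  · intro h
    have : ∀ z, φ₀ z = φ₀ 0 := by
      intro z
      rcases h01 z with rfl | rfl
      · rfl
      · exact h.symm
    simp [this (∑ j, _)] at hxa
  · refine ⟨x i, a, hne _ _ fun e => hxa ?_⟩
    dsimp only
    congr 1
    refine Finset.sum_congr rfl fun j _ => ?_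
    by_cases hj : j = i
    · subst hj
      simp [e]
    · simp [hj]

/-- Freeze all variables but two relevant ones, and let `F` and `G` flip the summands of these two.
Since `φ₀` is injective, a point indicator recovers `F + G`. -/
theorem IsRichClone.quasilinear_mem_of_quasilinear {C : Set Operation} (hC : IsRichClone C)
    {n N : ℕ+} {f : Op n} (hf : (⟨n, f⟩ : Operation) ∈ C) (hq : Quasilinear f)
    (hu : ¬ EssentiallyUnary f) {h : Op N} (hh : Quasilinear h) : (⟨N, h⟩ : Operation) ∈ C := by
  obtain ⟨φ₀, φ, hφ⟩ := hq
  obtain rfl : f = fun x => φ₀ (∑ i, φ i (x i)) := funext hφ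
  obtain ⟨i, j, hij, hi, hj⟩ := not_not.1 hu
  obtain ⟨hne, a, a', ha⟩ := exists_ne_of_dependsOnVar hi
  obtain ⟨-, b, b', hb⟩ := exists_ne_of_dependsOnVar hj
  refine hC.quasilinear_mem_of_add (fun F G hF hG => ?_) hh
  set c := ∑ k ∈ (Finset.univ.erase i).erase j, φ k 0
  have hsub := hC.unary_comp_mem (hC.pointIndicator_mem (φ₀ (φ i a + (φ j b + c) + 1)))
    (hC.substitution_mem hf (F := fun k => if k = i then F else G)
      (fun k => by by_cases hk : k = i <;> simp [hk, hF, hG])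
      (fun k z => if k = i then (if z = 0 then a else a') else
        if k = j then (if z = 0 then b else b') else 0))
  unfold HasPredicate
  convert hsub using 3 with z
  have h01 : ∀ z : ZMod 2, z = 0 ∨ z = 1 := by decide
  have hsum : ∑ k, φ k ((fun k z => if k = i then (if z = 0 then a else a') else
        if k = j then (if z = 0 then b else b') else 0) k
          ((fun k => if k = i then F else G) k z)) = φ i a + (φ j b + c) + (F z + G z) := by
    rw [← Finset.add_sum_erase _ _ (Finset.mem_univ i),
      ← Finset.add_sum_erase _ _ (Finset.mem_erase.2 ⟨hij.symm, Finset.mem_univ j⟩)]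
    have : ∑ k ∈ (Finset.univ.erase i).erase j,
        φ k ((fun k z => if k = i then (if z = 0 then a else a') else
        if k = j then (if z = 0 then b else b') else 0) k
          ((fun k => if k = i then F else G) k z)) = c := by
      refine Finset.sum_congr rfl fun k hk => ?_
      simp only [Finset.mem_erase, Finset.mem_univ, and_true] at hk
      simp [hk.1, hk.2]
    rw [this]
    rcases h01 (F z) with hF | hF <;> rcases h01 (G z) with hG | hG <;>
      simp [hF, hG, hij.symm, ha, hb] <;> ring
  rw [hsum]
  change (F z + G z).val = _
  generalize φ i a + (φ j b + c) = d
  generalize F z + G z = e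
  have h2 : (1 : ZMod 2) + 1 = 0 := by decide
  rcases h01 d with rfl | rfl <;> rcases h01 e with rfl | rfl <;>
    simp [pointIndicator, hne, hne.symm, h2, ZMod.val_one]

/-! ### Squares, ranges and quasilinearity -/

/-- Suppose every L-shaped triple repeats a value. A row with three values would force each column
to be constant, since two unequal entries of a column must cover every value of that row. So a
nonconstant row has exactly two values, and comparing with it confines `F` to these two. -/
theorem exists_three_values_of_depends {X Y : Type*} {F : X → Y → ℕ}
    (hx : ∃ x x' y, F x y ≠ F x' y) (hy : ∃ x y y', F x y ≠ F x y')
    (h3 : ¬ ∃ a b, ∀ x y, F x y = a ∨ F x y = b) :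
    ∃ x x' y y', F x y ≠ F x' y ∧ F x y ≠ F x y' ∧ F x' y ≠ F x y' := by
  by_contra hcon
  have hL : ∀ x x' y y', F x y = F x' y ∨ F x y = F x y' ∨ F x' y = F x y' := by
    intro x x' y y'
    by_contra! h
    exact hcon ⟨x, x', y, y', h⟩
  obtain ⟨x₀, p, q, hpq⟩ := hy
  have hrow : ∀ y, F x₀ y = F x₀ p ∨ F x₀ y = F x₀ q := by
    by_contra! h
    obtain ⟨r, hr⟩ := h
    obtain ⟨x, x', y, hne⟩ := hx
    have hcol : ∀ z, F z y = F x₀ y := by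
      intro z
      have h1 := hL x₀ z y p
      have h2 := hL x₀ z y q
      have h4 := hL x₀ z y r
      grind
    exact hne ((hcol x).trans (hcol x').symm)
  refine h3 ⟨F x₀ p, F x₀ q, fun x y => ?_⟩
  have h1 := hL x₀ x y p
  have h2 := hL x₀ x y q
  have h4 := hrow y
  grind

/-- The fourth corner of the square repeats at most one of three distinct values, so some corner is
isolated. -/
theorem hasIsolatedCorner_of_three_values {X Y : Type*} {F : X → Y → ℕ}
    (hx : ∃ x x' y, F x y ≠ F x' y) (hy : ∃ x y y', F x y ≠ F x y')
    (h3 : ¬ ∃ a b, ∀ x y, F x y = a ∨ F x y = b) : HasIsolatedCorner F := by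
  obtain ⟨x, x', y, y', h1, h2, h4⟩ := exists_three_values_of_depends hx hy h3
  by_cases h5 : F x' y' = F x y
  · exact ⟨x, x', y', y, by grind, by grind, by grind⟩
  · by_cases h6 : F x' y' = F x' y
    · exact ⟨x', x, y, y', by grind, by grind, by grind⟩
    · by_cases h7 : F x' y' = F x y'
      · exact ⟨x, x', y', y, by grind, by grind, by grind⟩
      · exact ⟨x, x', y, y', h5, h6, h7⟩

theorem exists_splitVar_depends {n : ℕ} {f : Op n} (hf : ¬ EssentiallyUnary f) :
    ∃ i, (∃ x x' y, splitVar f i x y ≠ splitVar f i x' y) ∧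
      ∃ x y y', splitVar f i x y ≠ splitVar f i x y' := by
  obtain ⟨i, j, hij, ⟨x, a, hi⟩, y, b, hj⟩ := not_not.1 hf
  refine ⟨i, ⟨a, x i, x, by simpa [splitVar] using hi⟩, y i, Function.update y j b, y, ?_⟩
  unfold splitVar
  rw [Function.update_comm hij.symm, Function.update_eq_self]
  exact hj

theorem splitVar_self {n : ℕ} (f : Op n) (i : Fin n) (x : Fin n → ℕ) :
    splitVar f i (x i) x = f x := by
  simp [splitVar]

theorem two_valued_of_splitVar {n : ℕ} {f : Op n} {i : Fin n} :
    (∃ a b, ∀ x y, splitVar f i x y = a ∨ splitVar f i x y = b) ↔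
      ∃ a b, ∀ x, f x = a ∨ f x = b := by
  constructor
  · rintro ⟨a, b, h⟩
    exact ⟨a, b, fun x => splitVar_self f i x ▸ h (x i) x⟩
  · rintro ⟨a, b, h⟩
    exact ⟨a, b, fun x y => h _⟩

/-- A function of `n` variables with vanishing mixed second differences is a sum of functions
of one variable. -/
theorem eq_sum_of_second_difference {n : ℕ} {F : (Fin n → ℕ) → ZMod 2}
    (h : ∀ (i : Fin n) (s s' : ℕ) (y y' : Fin n → ℕ),
      F (Function.update y i s) + F (Function.update y i s') +
        (F (Function.update y' i s) + F (Function.update y' i s')) = 0) (x : Fin n → ℕ) :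
    F x = (∑ i, (F (Function.update 0 i (x i)) + F 0)) + F 0 := by
  classical
  -- The coordinates of `x` are switched on one at a time, starting from the zero tuple.
  have key : ∀ s : Finset (Fin n), F (fun j => if j ∈ s then x j else 0) =
      (∑ i ∈ s, (F (Function.update 0 i (x i)) + F 0)) + F 0 := by
    intro s
    induction s using Finset.induction_on with
    | empty => simp; rfl
    | insert a s ha ih =>
      have h1 := h a (x a) 0 (fun j => if j ∈ s then x j else 0) 0
      have e1 : Function.update (fun j => if j ∈ s then x j else 0) a (x a) =
          fun j => if j ∈ insert a s then x j else 0 := by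
        funext j
        by_cases hj : j = a
        · subst hj; simp
        · simp [hj]
      have e2 : Function.update (fun j => if j ∈ s then x j else 0) a 0 =
          fun j => if j ∈ s then x j else 0 := by
        funext j
        by_cases hj : j = a
        · subst hj; simp [ha]
        · simp [hj]
      have e3 : Function.update (0 : Fin n → ℕ) a 0 = 0 := Function.update_eq_self a _
      rw [e1, e2, e3, ih] at h1
      rw [Finset.sum_insert ha]
      generalize F (fun j => if j ∈ insert a s then x j else 0) = t at *
      generalize (∑ i ∈ s, (F (Function.update 0 i (x i)) + F 0)) = r at *
      generalize F (Function.update 0 a (x a)) = p at *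
      generalize F 0 = q at *
      clear ih
      revert p q r t
      decide
  simpa using key Finset.univ

/-- Three values would create an isolated corner, so `f` is two-valued. An odd count of either value
on a square would isolate a corner as well, so the mixed second differences of `f`, coded in `ZMod
2`, vanish. -/
theorem quasilinear_of_no_isolatedCorner {n : ℕ} {f : Op n} (hf : ¬ EssentiallyUnary f)
    (h : ∀ i, ¬ HasIsolatedCorner (splitVar f i)) : Quasilinear f := by
  classical
  obtain ⟨i, hx, hy⟩ := exists_splitVar_depends hf
  obtain ⟨a, b, hab⟩ : ∃ a b, ∀ x, f x = a ∨ f x = b := by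
    rw [← two_valued_of_splitVar (i := i)]
    by_contra h3
    exact h i (hasIsolatedCorner_of_three_values hx hy h3)
  set F : (Fin n → ℕ) → ZMod 2 := fun x => if f x = a then 0 else 1 with hF
  have hsum := eq_sum_of_second_difference (F := F) (by
    intro i s s' y y'
    by_contra hne
    refine h i ?_
    unfold splitVar HasIsolatedCorner
    by_cases hba : b = a
    · have : ∀ x, f x = a := fun x => (hab x).elim id fun h => h.trans hba
      simp [hF, this] at hne
    have hb : ∀ x, f x ≠ a → f x = b := fun x => (hab x).resolve_left
    have h2 : (1 : ZMod 2) + 1 = 0 := by decide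
    by_cases h1 : f (Function.update y i s) = a <;> by_cases h3 : f (Function.update y i s') = a <;>
    by_cases h4 : f (Function.update y' i s) = a <;>
    by_cases h5 : f (Function.update y' i s') = a <;>
    simp only [hF, h1, h3, h4, h5, if_true, if_false, h2, add_zero, zero_add, not_true_eq_false] at hne <;>
    first
    | refine ⟨s, s', y, y', ?_⟩; simp [*, Ne.symm hba]; done
    | refine ⟨s', s, y, y', ?_⟩; simp [*, Ne.symm hba]; done
    | refine ⟨s, s', y', y, ?_⟩; simp [*, Ne.symm hba]; done
    | refine ⟨s', s, y', y, ?_⟩; simp [*, Ne.symm hba])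
  -- The constant term `F 0` is absorbed into the outer function.
  refine ⟨fun z => if z + F 0 = 0 then a else b,
    fun i t => F (Function.update 0 i t) + F 0, fun x => ?_⟩
  dsimp only
  rw [← hsum x]
  by_cases hxa : f x = a
  · simp [hF, hxa]
  · simp [hF, (hab x).resolve_left hxa]

/-! ### Generating operations of larger range -/

theorem Quasilinear.exists_two_values {n : ℕ} {f : Op n} (hf : Quasilinear f) :
    ∃ a b, ∀ x, f x = a ∨ f x = b := by
  obtain ⟨φ₀, φ, h⟩ := hf
  refine ⟨φ₀ 0, φ₀ 1, fun x => ?_⟩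
  have h01 : ∀ z : ZMod 2, z = 0 ∨ z = 1 := by decide
  rw [h]
  rcases h01 (∑ i, φ i (x i)) with e | e <;> simp [e]

theorem encard_range_le_two {X : Type*} {f : X → ℕ} {a b : ℕ} (h : ∀ x, f x = a ∨ f x = b) :
    (Set.range f).encard ≤ 2 := by
  refine (Set.encard_le_encard (t := ({a, b} : Finset ℕ)) ?_).trans ?_
  swap
  · rw [Set.encard_coe_eq_coe_finsetCard]
    exact_mod_cast Finset.card_le_two
  rintro _ ⟨x, rfl⟩
  simpa using h x

theorem exists_finset_range_subset {X : Type*} {h : X → ℕ} {n : ℕ}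
    (hh : (Set.range h).encard ≤ n) : ∃ Z : Finset ℕ, Z.card = n ∧ ∀ x, h x ∈ Z := by
  have hfin := Set.finite_of_encard_le_coe hh
  rw [hfin.encard_eq_coe_toFinset_card] at hh
  obtain ⟨Z, hZ, hc⟩ := Infinite.exists_superset_card_eq hfin.toFinset n (by exact_mod_cast hh)
  exact ⟨Z, hc, fun x => hZ (by simp)⟩

namespace IsRichClone

variable {C : Set Operation} {n N : ℕ+} {f : Op n}

theorem quasilinear_mem (hC : IsRichClone C) (hf : (⟨n, f⟩ : Operation) ∈ C)
    (hu : ¬ EssentiallyUnary f) {h : Op N} (hh : Quasilinear h) : (⟨N, h⟩ : Operation) ∈ C := by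
  by_cases hc : ∃ i, HasIsolatedCorner (splitVar f i)
  · obtain ⟨i, hi⟩ := hc
    obtain ⟨a, b, hab⟩ := hh.exists_two_values
    exact hC.mem_of_isolatedCorner hf hi (encard_range_le_two hab)
  · exact hC.quasilinear_mem_of_quasilinear hf
      (quasilinear_of_no_isolatedCorner hu (not_exists.1 hc)) hu hh

theorem mem_of_encard_range_le_two (hC : IsRichClone C) (hf : (⟨n, f⟩ : Operation) ∈ C)
    (hu : ¬ EssentiallyUnary f) (hq : ¬ Quasilinear f) {h : Op N}
    (hh : (Set.range h).encard ≤ 2) : (⟨N, h⟩ : Operation) ∈ C := by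
  obtain ⟨i, hi⟩ : ∃ i, HasIsolatedCorner (splitVar f i) := by
    by_contra hc
    exact hq (quasilinear_of_no_isolatedCorner hu (not_exists.1 hc))
  exact hC.mem_of_isolatedCorner hf hi hh

/-- If `f` attains distinct values at three tuples, two of which agree in each coordinate, then
an operation with as many values as `f` is a composition of `f` with operations with fewer values. -/
theorem mem_of_three_values (hC : IsRichClone C) (hf : (⟨n, f⟩ : Operation) ∈ C) {k : ℕ}
    (hk : 3 ≤ k + 1) (hkf : ((k + 1 : ℕ) : ℕ∞) ≤ (Set.range f).encard)
    {p q r : Fin n → ℕ} (hpq : f p ≠ f q) (hpr : f p ≠ f r) (hqr : f q ≠ f r)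
    (hcoord : ∀ j, p j = q j ∨ p j = r j)
    (ih : ∀ h : Op N, (Set.range h).encard ≤ k → (⟨N, h⟩ : Operation) ∈ C)
    {h : Op N} (hh : (Set.range h).encard ≤ (k + 1 : ℕ)) : (⟨N, h⟩ : Operation) ∈ C := by
  classical
  obtain ⟨V, hVc, hV, hpV, hqV, hrV⟩ : ∃ V : Finset ℕ, V.card = k + 1 ∧
      (V : Set ℕ) ⊆ Set.range f ∧ f p ∈ V ∧ f q ∈ V ∧ f r ∈ V := by
    obtain ⟨T, h1, h2, h3⟩ := Set.exists_superset_subset_encard_eq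
      (s := ({f p, f q, f r} : Set ℕ)) (t := Set.range f) (k := (k + 1 : ℕ)) (by
        rintro _ (rfl | rfl | rfl) <;> simp) (by
        rw [Set.encard_eq_three.2 ⟨_, _, _, hpq, hpr, hqr, rfl⟩]
        exact_mod_cast hk) hkf
    have hfin := Set.finite_of_encard_eq_coe h3
    rw [hfin.encard_eq_coe_toFinset_card] at h3
    refine ⟨hfin.toFinset, by exact_mod_cast h3, by simpa using h2, ?_, ?_, ?_⟩ <;>
      simp only [Set.Finite.mem_toFinset] <;> apply h1 <;> simp
  obtain ⟨Z, hZc, hZ⟩ := exists_finset_range_subset hh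
  obtain ⟨σ, hσ⟩ := exists_perm_image_eq (hZc.trans hVc.symm)
  -- A section of `f` over `V` that passes through the three given tuples.
  obtain ⟨sel, hsel, hp, hq, hr⟩ : ∃ sel : ℕ → Fin n → ℕ, (∀ v ∈ V, f (sel v) = v) ∧
      sel (f p) = p ∧ sel (f q) = q ∧ sel (f r) = r := by
    have hV' : ∀ v ∈ V, ∃ x, f x = v := fun v hv => hV hv
    choose! s hs using hV'
    refine ⟨fun v => if v = f p then p else if v = f q then q else if v = f r then r else s v,
      fun v hv => ?_, by simp, by simp [hpq.symm], by simp [hpr.symm, hqr.symm]⟩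
    by_cases h1 : v = f p
    · simp [h1]
    by_cases h2 : v = f q
    · simp [h2, hpq.symm]
    by_cases h3 : v = f r
    · simp [h3, hpr.symm, hqr.symm]
    · simp only [h1, h2, h3, if_false]
      exact hs v hv
  have hmemV : ∀ x, σ (h x) ∈ V := fun x => hσ ▸ Finset.mem_image_of_mem _ (hZ x)
  have hmem : ∀ j : Fin n, (⟨N, fun x => sel (σ (h x)) j⟩ : Operation) ∈ C := by
    intro j
    refine ih _ ((Set.encard_le_encard (t := ((V.image (fun v => sel v j) : Finset ℕ) : Set ℕ))
      ?_).trans ?_)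
    · rintro _ ⟨x, rfl⟩
      exact_mod_cast Finset.mem_image_of_mem (fun v => sel v j) (hmemV x)
    -- In coordinate `j` the section agrees at two distinct values, so at least one value is lost.
    · have hlt : (V.image (fun v => sel v j)).card < V.card := by
        refine lt_of_le_of_ne Finset.card_image_le fun e => ?_
        have hinj := Finset.card_image_iff.1 e
        rcases hcoord j with hj | hj
        · exact hpq (hinj hpV hqV (by simpa [hp, hq] using hj))
        · exact hpr (hinj hpV hrV (by simpa [hp, hr] using hj))
      rw [Set.encard_coe_eq_coe_finsetCard]
      exact_mod_cast (by omega : (V.image (fun v => sel v j)).card ≤ k)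
  have := hC.unary_comp_mem (hC.perm_mem σ.symm) (hC.comp_mem n N f _ hf hmem)
  convert this using 3 with x
  rw [hsel _ (hmemV x), σ.symm_apply_apply]

theorem mem_of_encard_range_le (hC : IsRichClone C) (hf : (⟨n, f⟩ : Operation) ∈ C)
    (hu : ¬ EssentiallyUnary f) (hq : ¬ Quasilinear f) {k : ℕ} (hk : 2 ≤ k)
    (hkf : (k : ℕ∞) ≤ (Set.range f).encard) :
    ∀ h : Op N, (Set.range h).encard ≤ k → (⟨N, h⟩ : Operation) ∈ C := by
  induction k, hk using Nat.le_induction with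
  | base => exact fun h hh => hC.mem_of_encard_range_le_two hf hu hq hh
  | succ k hk ih =>
    intro h hh
    obtain ⟨i, hx, hy⟩ := exists_splitVar_depends hu
    have h3 : ¬ ∃ a b, ∀ x y, splitVar f i x y = a ∨ splitVar f i x y = b := by
      rw [two_valued_of_splitVar]
      rintro ⟨a, b, hab⟩
      have h1 := hkf.trans (encard_range_le_two hab)
      have h2 : k + 1 ≤ 2 := by exact_mod_cast h1
      omega
    obtain ⟨s, s', y, y', h1, h2, h4⟩ := exists_three_values_of_depends hx hy h3
    -- The first tuple agrees with the third in coordinate `i` and with the second elsewhere.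
    refine hC.mem_of_three_values hf (by omega) hkf (p := Function.update y i s)
      (q := Function.update y i s') (r := Function.update y' i s) h1 h2 h4 (fun j => ?_)
      (ih (le_trans (by exact_mod_cast k.le_succ) hkf)) hh
    by_cases hj : j = i
    · subst hj; simp
    · simp [hj]

theorem eq_univ_of_forall_encard_range_le (hC : IsRichClone C)
    (h : ∀ (N : ℕ+) (k : ℕ) (h : Op N), (Set.range h).encard ≤ k → (⟨N, h⟩ : Operation) ∈ C) :
    C = Set.univ := by
  classical
  refine Set.eq_univ_of_forall fun ⟨N, g⟩ => ?_
  refine (hC.isClosed N).mem_of_forall_finset fun A => ?_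
  refine ⟨fun x => if x ∈ A then g x else 0, h N (insert 0 (A.image g)).card _ ?_,
    fun x hx => by simp [hx]⟩
  rw [← Set.encard_coe_eq_coe_finsetCard]
  refine Set.encard_le_encard ?_
  rintro _ ⟨x, rfl⟩
  by_cases hx : x ∈ A
  · simp only [hx, if_true]
    exact_mod_cast Finset.mem_insert_of_mem (Finset.mem_image_of_mem g hx)
  · simp [hx]

end IsRichClone

/-! ### The clone generated by the monoid -/

/-- The unary operation obtained by identifying all variables. -/
def diagonal {n : ℕ} (f : Op n) (t : ℕ) : ℕ := f fun _ => t

theorem eq_of_not_dependsOnVar {n : ℕ} {f : Op n} (s : Finset (Fin n))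
    (hs : ∀ j ∈ s, ¬ DependsOnVar f j) {x y : Fin n → ℕ} (hxy : ∀ j ∉ s, x j = y j) :
    f x = f y := by
  classical
  induction s using Finset.induction_on generalizing x with
  | empty => exact congrArg f (funext fun j => hxy j (Finset.notMem_empty j))
  | insert a s ha ih =>
    have h1 : f (Function.update x a (y a)) = f x := by
      by_contra h
      exact hs a (Finset.mem_insert_self a s) ⟨x, y a, h⟩
    rw [← h1]
    refine ih (fun j hj => hs j (Finset.mem_insert_of_mem hj)) fun j hj => ?_
    by_cases hja : j = a
    · subst hja; simp
    · simp [hja, hxy j (by simp [hja, hj])]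

theorem EssentiallyUnary.exists_eq {n : ℕ+} {f : Op n} (hf : EssentiallyUnary f) :
    ∃ i, ∀ x, f x = diagonal f (x i) := by
  classical
  obtain ⟨i, hi⟩ : ∃ i, ∀ j, j ≠ i → ¬ DependsOnVar f j := by
    by_cases h : ∃ i, DependsOnVar f i
    · obtain ⟨i, hi⟩ := h
      exact ⟨i, fun j hj hd => hf ⟨j, i, hj, hd, hi⟩⟩
    · exact ⟨⟨0, n.pos⟩, fun j _ hd => h ⟨j, hd⟩⟩
  refine ⟨i, fun x => eq_of_not_dependsOnVar (Finset.univ.erase i)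
    (fun j hj => hi j (Finset.ne_of_mem_erase hj)) fun j hj => ?_⟩
  have : j = i := by simpa using hj
  rw [this]

theorem essentiallyUnary_of_eq {n : ℕ} {f : Op n} {h : ℕ → ℕ} {i : Fin n}
    (hf : ∀ x, f x = h (x i)) : EssentiallyUnary f := by
  have key : ∀ j, DependsOnVar f j → j = i := by
    rintro j ⟨x, a, hne⟩
    by_contra hj
    exact hne (by simp [hf, Function.update_of_ne (Ne.symm hj)])
  rintro ⟨j, k, hjk, hj, hk⟩
  exact hjk ((key j hj).trans (key k hk).symm)

/-- The essentially unary operations whose diagonal belongs to `M`. -/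
def essentiallyUnaryOver (M : Set (ℕ → ℕ)) : Set Operation :=
  {f | EssentiallyUnary f.2 ∧ diagonal f.2 ∈ M}

theorem mem_essentiallyUnaryOver_iff {M : Set (ℕ → ℕ)} {n : ℕ+} {f : Op n} :
    (⟨n, f⟩ : Operation) ∈ essentiallyUnaryOver M ↔ ∃ h ∈ M, ∃ i, ∀ x, f x = h (x i) := by
  constructor
  · rintro ⟨h1, h2⟩
    exact ⟨_, h2, h1.exists_eq⟩
  · rintro ⟨h, hM, i, hf⟩
    refine ⟨essentiallyUnary_of_eq hf, ?_⟩
    rwa [show diagonal f = h from funext fun t => hf _]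

theorem isLocalClone_essentiallyUnaryOver {M : Set (ℕ → ℕ)} (hM : IsLocalMonoid M) :
    IsLocalClone (essentiallyUnaryOver M) where
  proj_mem n i := mem_essentiallyUnaryOver_iff.2 ⟨id, hM.id_mem, i, fun _ => rfl⟩
  comp_mem n m f g hf hg := by
    obtain ⟨h, hh, i, hf⟩ := mem_essentiallyUnaryOver_iff.1 hf
    obtain ⟨h', hh', j, hg⟩ := mem_essentiallyUnaryOver_iff.1 (hg i)
    exact mem_essentiallyUnaryOver_iff.2
      ⟨h ∘ h', hM.comp_mem _ hh _ hh', j, fun x => by simp [hf, hg]⟩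
  isClosed n := by
    classical
    refine isClosed_of_forall_finset fun f hf => ⟨?_, ?_⟩
    · rintro ⟨i, j, hij, ⟨x, a, hx⟩, y, b, hy⟩
      -- Dependence on two variables is visible on four tuples.
      obtain ⟨g, ⟨hg, -⟩, hgA⟩ := hf {x, Function.update x i a, y, Function.update y j b}
      refine hg ⟨i, j, hij, ⟨x, a, ?_⟩, y, b, ?_⟩
      · dsimp only
        rwa [hgA _ (by simp), hgA _ (by simp)]
      · dsimp only
        rwa [hgA _ (by simp), hgA _ (by simp)]
    · refine hM.isClosed.mem_of_forall_finset fun A => ?_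
      obtain ⟨g, ⟨-, hg⟩, hgA⟩ := hf (A.image fun t _ => t)
      exact ⟨_, hg, fun t ht => hgA _ (Finset.mem_image_of_mem _ ht)⟩

theorem essentiallyUnaryOver_subset {M : Set (ℕ → ℕ)} {C : Set Operation} (hC : IsClone C)
    (h : ∀ u ∈ M, unaryOperation u ∈ C) : essentiallyUnaryOver M ⊆ C := by
  rintro ⟨n, f⟩ hf
  obtain ⟨u, hu, i, hf⟩ := mem_essentiallyUnaryOver_iff.1 hf
  obtain rfl : f = fun x => u (x i) := funext hf
  exact hC.unary_comp_mem (h u hu) (hC.proj_mem n i)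

theorem unaryOperation_mem_essentiallyUnaryOver_iff {M : Set (ℕ → ℕ)} {h : ℕ → ℕ} :
    unaryOperation h ∈ essentiallyUnaryOver M ↔ h ∈ M :=
  ⟨fun hh => hh.2, fun hh => ⟨essentiallyUnary_of_eq (h := h) (i := (0 : Fin 1)) fun _ => rfl, hh⟩⟩

theorem cloneOf_eq {M : Set (ℕ → ℕ)} (hM : IsLocalMonoid M) :
    cloneOf M = essentiallyUnaryOver M := by
  apply Set.Subset.antisymm
  · refine Set.sInter_subset_of_mem ⟨isLocalClone_essentiallyUnaryOver hM, ?_⟩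
    rintro _ ⟨h, hh, rfl⟩
    exact unaryOperation_mem_essentiallyUnaryOver_iff.2 hh
  · refine Set.subset_sInter fun C hC => ?_
    exact essentiallyUnaryOver_subset hC.1.toIsClone fun u hu => hC.2 ⟨u, hu, rfl⟩

/-! ### Burle's clone and the range clones are local clones -/

theorem isClosed_encard_range_lt (X : Type*) [Nonempty X] (n : ℕ) :
    IsClosed {f : X → ℕ | (Set.range f).encard < n} := by
  classical
  refine isClosed_of_forall_finset fun f hf => ?_
  by_contra hn
  obtain ⟨T, hT, hTn⟩ := Set.exists_subset_encard_eq (not_lt.1 hn)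
  have hfin := Set.finite_of_encard_eq_coe hTn
  have hT' : ∀ t ∈ T, ∃ x, f x = t := fun t ht => hT ht
  choose! s hs using hT'
  obtain ⟨g, hg, hgA⟩ := hf (hfin.toFinset.image s)
  refine absurd (show (Set.range g).encard < n from hg) (not_lt.2 ?_)
  rw [← hTn]
  refine Set.encard_le_encard fun t ht => ⟨s t, ?_⟩
  rw [hgA _ (Finset.mem_image_of_mem _ (by simpa using ht)), hs t ht]

/-- The inner sums at the four corners add up to `0` modulo `2`, so none of them occurs exactly
once. -/
theorem Quasilinear.not_hasIsolatedCorner {n : ℕ} {f : Op n} (hf : Quasilinear f) (i : Fin n) :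
    ¬ HasIsolatedCorner (splitVar f i) := by
  classical
  obtain ⟨φ₀, φ, hφ⟩ := hf
  have hsplit : ∀ s y, splitVar f i s y = φ₀ (φ i s + ∑ j ∈ Finset.univ.erase i, φ j (y j)) := by
    intro s y
    unfold splitVar
    rw [hφ, ← Finset.add_sum_erase _ _ (Finset.mem_univ i), Function.update_self]
    congr 2
    exact Finset.sum_congr rfl fun j hj => by
      rw [Function.update_of_ne (Finset.ne_of_mem_erase hj)]
  rintro ⟨s, s', y, y', h1, h2, h3⟩
  rw [hsplit, hsplit] at h1 h2 h3
  have key : ∀ p p' q q' : ZMod 2,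
      p' + q' = p + q ∨ p' + q' = p' + q ∨ p' + q' = p + q' := by decide
  rcases key (φ i s) (φ i s') (∑ j ∈ Finset.univ.erase i, φ j (y j))
    (∑ j ∈ Finset.univ.erase i, φ j (y' j)) with h | h | h
  · exact h1 (congrArg φ₀ h)
  · exact h2 (congrArg φ₀ h)
  · exact h3 (congrArg φ₀ h)

theorem EssentiallyUnary.quasilinear {n : ℕ+} {f : Op n} (hf : EssentiallyUnary f) {a b : ℕ}
    (hab : ∀ x, f x = a ∨ f x = b) : Quasilinear f := by
  classical
  obtain ⟨i, hi⟩ := hf.exists_eq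
  refine ⟨fun z => if z = 0 then a else b,
    fun j t => if j = i then (if diagonal f t = a then 0 else 1) else 0, fun x => ?_⟩
  simp only [Finset.sum_ite_eq', Finset.mem_univ, if_true, ← hi]
  by_cases h : f x = a
  · simp [h]
  · simp [(hab x).resolve_left h]

theorem exists_two_values_of_encard_lt {X : Type*} {f : X → ℕ}
    (hf : (Set.range f).encard < 3) : ∃ a b, ∀ x, f x = a ∨ f x = b := by
  have h2 : (Set.range f).encard ≤ (2 : ℕ) := by
    refine ENat.lt_add_one_iff (by simp) |>.1 ?_
    exact hf.trans_eq (by norm_num)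
  obtain ⟨Z, hZ, hfZ⟩ := exists_finset_range_subset h2
  obtain ⟨a, b, -, rfl⟩ := Finset.card_eq_two.1 hZ
  exact ⟨a, b, fun x => by simpa using hfZ x⟩

/-- An essentially unary limit is still two-valued, hence quasilinear. For any other limit, an
isolated corner would already show on the four tuples of a square. -/
theorem isClosed_quasilinear (n : ℕ+) : IsClosed {f : Op n | Quasilinear f} := by
  classical
  refine isClosed_of_forall_finset fun f hf => ?_
  by_cases hu : EssentiallyUnary f
  · have h3 : f ∈ {f : Op n | (Set.range f).encard < (3 : ℕ)} := by
      refine (isClosed_encard_range_lt _ 3).mem_of_forall_finset fun A => ?_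
      obtain ⟨g, hg, hgA⟩ := hf A
      obtain ⟨a, b, hab⟩ := hg.exists_two_values
      exact ⟨g, (encard_range_le_two hab).trans_lt (by norm_num), hgA⟩
    obtain ⟨a, b, hab⟩ := exists_two_values_of_encard_lt h3
    exact hu.quasilinear hab
  · refine quasilinear_of_no_isolatedCorner hu fun i hi => ?_
    obtain ⟨s, s', y, y', h⟩ := hi
    obtain ⟨g, hg, hgA⟩ := hf {Function.update y i s, Function.update y i s',
      Function.update y' i s, Function.update y' i s'}
    refine hg.not_hasIsolatedCorner i ⟨s, s', y, y', ?_⟩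
    unfold splitVar at h ⊢
    rwa [hgA _ (by simp), hgA _ (by simp), hgA _ (by simp), hgA _ (by simp)]

/-- Every map `ZMod 2 → ZMod 2` is affine, so `φ ∘ φ₀` can be pushed into the summands; the constant
term is charged to the first variable. This makes a quasilinear operation of members of Burle's
clone quasilinear. -/
theorem exists_eq_sum_of_mem {M : Set (ℕ → ℕ)} {n : ℕ+} {g : Op n}
    (hg : (⟨n, g⟩ : Operation) ∈ essentiallyUnaryOver M ∪ quasilinearOperations)
    (φ : ℕ → ZMod 2) : ∃ ψ : Fin n → ℕ → ZMod 2, ∀ x, φ (g x) = ∑ j, ψ j (x j) := by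
  classical
  rcases hg with hg | ⟨φ₀, ψ, hψ⟩
  · obtain ⟨h, -, i, hf⟩ := mem_essentiallyUnaryOver_iff.1 hg
    exact ⟨fun j t => if j = i then φ (h t) else 0, fun x => by simp [hf]⟩
  · refine ⟨fun j t => (φ (φ₀ 1) + φ (φ₀ 0)) * ψ j t +
      if j = ⟨0, n.pos⟩ then φ (φ₀ 0) else 0, fun x => ?_⟩
    rw [Finset.sum_add_distrib, ← Finset.mul_sum, show g x = φ₀ (∑ j, ψ j (x j)) from hψ x]
    simp only [Finset.sum_ite_eq', Finset.mem_univ, if_true]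
    have h2 : ∀ z w : ZMod 2, z = z + w + w := by decide
    have h01 : ∀ z : ZMod 2, z = 0 ∨ z = 1 := by decide
    rcases h01 (∑ j, ψ j (x j)) with h | h <;> simp [h, ← h2]

theorem isLocalClone_burleCloneOver {M : Set (ℕ → ℕ)} (hM : IsLocalMonoid M) :
    IsLocalClone (burleCloneOver M) := by
  have hU := isLocalClone_essentiallyUnaryOver hM
  unfold burleCloneOver
  rw [cloneOf_eq hM]
  refine ⟨⟨fun n i => Or.inl (hU.proj_mem n i), fun n m f g hf hg => ?_⟩,
    fun n => (hU.isClosed n).union (isClosed_quasilinear n)⟩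
  rcases hf with hf | ⟨φ₀, φ, hφ⟩
  · obtain ⟨h, hh, i, hfi⟩ := mem_essentiallyUnaryOver_iff.1 hf
    rcases hg i with hgi | ⟨φ₀, φ, hφ⟩
    · obtain ⟨h', hh', j, hgj⟩ := mem_essentiallyUnaryOver_iff.1 hgi
      exact Or.inl (mem_essentiallyUnaryOver_iff.2
        ⟨h ∘ h', hM.comp_mem _ hh _ hh', j, fun x => by simp [hfi, hgj]⟩)
    · exact Or.inr ⟨h ∘ φ₀, φ, fun x => by simpa [hfi] using congrArg h (hφ x)⟩
  · choose ψ hψ using fun i => exists_eq_sum_of_mem (hg i) (φ i)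
    refine Or.inr ⟨φ₀, fun j t => ∑ i, ψ i j t, fun x => ?_⟩
    dsimp only at hφ ⊢
    rw [hφ, Finset.sum_comm]
    simp only [hψ]

theorem mem_rangeLtOperations_iff {k : ℕ} {f : Operation} :
    f ∈ rangeLtOperations k ↔ (Set.range f.2).encard < k :=
  Iff.rfl

theorem isLocalClone_rangeCloneOver {M : Set (ℕ → ℕ)} (hM : IsLocalMonoid M) (n : ℕ) :
    IsLocalClone (rangeCloneOver M n) := by
  have hU := isLocalClone_essentiallyUnaryOver hM
  unfold rangeCloneOver
  rw [cloneOf_eq hM]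
  refine ⟨⟨fun n i => Or.inl (hU.proj_mem n i), fun k m f g hf hg => ?_⟩,
    fun k => (hU.isClosed k).union (isClosed_encard_range_lt _ n)⟩
  rcases hf with hf | hf
  · obtain ⟨h, hh, i, hfi⟩ := mem_essentiallyUnaryOver_iff.1 hf
    rcases hg i with hgi | hgi
    · obtain ⟨h', hh', j, hgj⟩ := mem_essentiallyUnaryOver_iff.1 hgi
      exact Or.inl (mem_essentiallyUnaryOver_iff.2
        ⟨h ∘ h', hM.comp_mem _ hh _ hh', j, fun x => by simp [hfi, hgj]⟩)
    · refine Or.inr (mem_rangeLtOperations_iff.2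
        (lt_of_le_of_lt ?_ (mem_rangeLtOperations_iff.1 hgi)))
      refine (Set.encard_le_encard ?_).trans (Set.encard_image_le h _)
      rintro _ ⟨x, rfl⟩
      exact ⟨g i x, ⟨x, rfl⟩, (hfi fun i => g i x).symm⟩
  · refine Or.inr (mem_rangeLtOperations_iff.2
      (lt_of_le_of_lt (Set.encard_le_encard ?_) (mem_rangeLtOperations_iff.1 hf)))
    rintro _ ⟨x, rfl⟩
    exact ⟨_, rfl⟩

/-! ### The chain of clones -/

theorem range_ofUnary (h : ℕ → ℕ) : Set.range (ofUnary h) = Set.range h := by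
  ext y
  constructor
  · rintro ⟨x, rfl⟩
    exact ⟨x 0, rfl⟩
  · rintro ⟨t, rfl⟩
    exact ⟨fun _ => t, rfl⟩

theorem ContainsRangeLe.mono {M : Set (ℕ → ℕ)} {j k : ℕ} (hk : ContainsRangeLe M k) (hjk : j ≤ k) :
    ContainsRangeLe M j :=
  fun h hh => hk h (hh.trans (by exact_mod_cast hjk))

/-- The members of the monoidal interval of `M`, possibly without the clone of all operations,
provided that `M` contains enough transformations of finite range. -/
def intervalChain (M : Set (ℕ → ℕ)) : ℕ → Set Operation
  | 0 => cloneOf M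
  | 1 => burleCloneOver M
  | n + 2 => rangeCloneOver M (n + 3)

theorem intervalChain_sub_one {M : Set (ℕ → ℕ)} {n : ℕ} (hn : 3 ≤ n) :
    intervalChain M (n - 1) = rangeCloneOver M n := by
  obtain ⟨m, rfl⟩ := Nat.exists_eq_add_of_le hn
  rw [show 3 + m - 1 = m + 2 by omega, show 3 + m = m + 3 by omega]
  rfl

theorem mem_monoidalInterval_of_subset {M : Set (ℕ → ℕ)} {C : Set Operation} (hC : IsLocalClone C)
    (h1 : cloneOf M ⊆ C) (h2 : ∀ h, unaryOperation h ∈ C → h ∈ M) :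
    C ∈ monoidalInterval M := by
  refine ⟨hC, Set.Subset.antisymm h2 fun h hh => h1 ?_⟩
  exact Set.mem_sInter.2 fun D hD => hD.2 ⟨h, hh, rfl⟩

theorem cloneOf_mem_monoidalInterval {M : Set (ℕ → ℕ)} (hM : IsLocalMonoid M) :
    cloneOf M ∈ monoidalInterval M := by
  refine mem_monoidalInterval_of_subset ?_ le_rfl ?_
  · rw [cloneOf_eq hM]
    exact isLocalClone_essentiallyUnaryOver hM
  · rw [cloneOf_eq hM]
    exact fun h => unaryOperation_mem_essentiallyUnaryOver_iff.1

/-- For `n ≥ 2` the clone with index `n` adds the operations with at most `n` values, so `hn` keeps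
its unary part inside `M`. Index `1` needs `h2` instead, because quasilinear operations can take two
values. -/
theorem intervalChain_mem {M : Set (ℕ → ℕ)} (hM : IsLocalMonoid M) (h2 : ContainsRangeLe M 2)
    {n : ℕ} (hn : ContainsRangeLe M n) : intervalChain M n ∈ monoidalInterval M := by
  match n with
  | 0 => exact cloneOf_mem_monoidalInterval hM
  | 1 =>
    refine mem_monoidalInterval_of_subset (isLocalClone_burleCloneOver hM)
      Set.subset_union_left fun h hh => ?_
    rcases hh with hh | hh
    · rw [cloneOf_eq hM] at hh
      exact unaryOperation_mem_essentiallyUnaryOver_iff.1 hh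
    · obtain ⟨a, b, hab⟩ := Quasilinear.exists_two_values hh
      exact h2 h (encard_range_le_two fun t => hab fun _ => t)
  | n + 2 =>
    refine mem_monoidalInterval_of_subset (isLocalClone_rangeCloneOver hM _)
      Set.subset_union_left fun h hh => ?_
    rcases hh with hh | hh
    · rw [cloneOf_eq hM] at hh
      exact unaryOperation_mem_essentiallyUnaryOver_iff.1 hh
    · refine hn h ?_
      have hh : (Set.range (ofUnary h)).encard < ((n + 3 : ℕ) : ℕ∞) := hh
      rw [range_ofUnary] at hh
      exact (ENat.lt_add_one_iff (by simp)).1 (hh.trans_eq (by push_cast; ring))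

theorem not_essentiallyUnary_of_ne {n : ℕ} {f : Op n} {i j : Fin n} (hij : i ≠ j)
    (hi : f (Function.update 0 i 1) ≠ f 0) {x : Fin n → ℕ}
    (hj : f (Function.update x j 1) ≠ f x) : ¬ EssentiallyUnary f :=
  fun h => h ⟨i, j, hij, ⟨0, 1, hi⟩, x, 1, hj⟩

theorem exists_quasilinear_not_essentiallyUnary :
    ∃ f : Op 2, Quasilinear f ∧ ¬ EssentiallyUnary f := by
  refine ⟨fun x => (∑ i, if x i = 0 then (0 : ZMod 2) else 1).val,
    ⟨ZMod.val, fun _ t => if t = 0 then 0 else 1, fun _ => rfl⟩, ?_⟩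
  refine not_essentiallyUnary_of_ne (i := 0) (j := 1) (x := 0) (by decide) ?_ ?_ <;>
    simp [Fin.sum_univ_two, ZMod.val_one]

theorem exists_encard_range_lt_not_quasilinear :
    ∃ f : Op 2, (Set.range f).encard < 3 ∧ ¬ Quasilinear f ∧ ¬ EssentiallyUnary f := by
  refine ⟨fun x => if x 0 = 1 ∧ x 1 = 1 then 1 else 0, ?_, fun hq => ?_, ?_⟩
  · refine (encard_range_le_two (a := 1) (b := 0) fun x => ?_).trans_lt (by norm_num)
    split_ifs <;> simp
  · exact hq.not_hasIsolatedCorner 0 ⟨0, 1, 0, fun _ => 1, by simp [splitVar]⟩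
  · rintro h
    refine h ⟨0, 1, by decide, ⟨fun _ => 1, 0, by simp⟩, fun _ => 1, 0, by simp⟩

theorem exists_encard_range_eq (n : ℕ) :
    ∃ f : Op 2, (Set.range f).encard = (n + 2 : ℕ) ∧ ¬ EssentiallyUnary f := by
  refine ⟨fun x => min (x 0 + x 1) (n + 1), ?_, ?_⟩
  · have : Set.range (fun x : Fin 2 → ℕ => min (x 0 + x 1) (n + 1)) =
        (Finset.range (n + 2) : Set ℕ) := by
      ext y
      simp only [Set.mem_range, Finset.coe_range, Set.mem_Iio]
      constructor
      · rintro ⟨x, rfl⟩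
        omega
      · intro hy
        exact ⟨![y, 0], by simp; omega⟩
    rw [this, Set.encard_coe_eq_coe_finsetCard, Finset.card_range]
  · exact not_essentiallyUnary_of_ne (i := 0) (j := 1) (x := 0) (by decide) (by simp) (by simp)

/-- Neighbours are separated by binary operations that are not essentially unary: addition modulo
`2`, conjunction, and truncated addition. -/
theorem intervalChain_strictMono {M : Set (ℕ → ℕ)} (hM : IsLocalMonoid M) :
    StrictMono (intervalChain M) := by
  have hU : ∀ {f : Op 2}, ¬ EssentiallyUnary f → (⟨2, f⟩ : Operation) ∉ cloneOf M := by
    intro f hf h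
    rw [cloneOf_eq hM] at h
    exact hf h.1
  refine strictMono_nat_of_lt_succ fun n => ?_
  match n with
  | 0 =>
    obtain ⟨f, hq, hu⟩ := exists_quasilinear_not_essentiallyUnary
    exact Set.ssubset_iff_exists.2 ⟨Set.subset_union_left, ⟨2, f⟩, Or.inr hq, hU hu⟩
  | 1 =>
    obtain ⟨f, hf, hq, hu⟩ := exists_encard_range_lt_not_quasilinear
    refine Set.ssubset_iff_exists.2 ⟨Set.union_subset_union_right _ fun g hg => ?_, ⟨2, f⟩,
      Or.inr hf, fun h => h.elim (hU hu) hq⟩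
    obtain ⟨a, b, hab⟩ := Quasilinear.exists_two_values hg
    exact (encard_range_le_two hab).trans_lt (by norm_num)
  | n + 2 =>
    obtain ⟨f, hf, hu⟩ := exists_encard_range_eq (n + 1)
    refine Set.ssubset_iff_exists.2 ⟨Set.union_subset_union_right _ fun g hg => ?_, ⟨2, f⟩,
      Or.inr ?_, fun h => h.elim (hU hu) fun h => ?_⟩
    · exact mem_rangeLtOperations_iff.2 (lt_of_lt_of_le (mem_rangeLtOperations_iff.1 hg) (by exact_mod_cast (by omega : n + 3 ≤ n + 1 + 3)))
    · exact hf.trans_lt (by exact_mod_cast (by omega : n + 1 + 2 < n + 1 + 3))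
    · exact absurd hf (ne_of_lt (show (Set.range f).encard < ((n + 3 : ℕ) : ℕ∞) from h))

/-! ### Classification of the interval -/

theorem two_le_encard_range {n : ℕ} {f : Op n} (hf : ¬ EssentiallyUnary f) :
    2 ≤ (Set.range f).encard := by
  obtain ⟨i, j, hij, ⟨x, a, hx⟩, -⟩ := not_not.1 hf
  rw [← Set.encard_pair hx]
  exact Set.encard_le_encard (by rintro _ (rfl | rfl) <;> simp)

theorem isRichClone_of_mem_monoidalInterval {M : Set (ℕ → ℕ)} (hM : IsLocalMonoid M)
    (hperm : ∀ σ : Equiv.Perm ℕ, (⇑σ : ℕ → ℕ) ∈ M)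
    (hlarge : ∃ f ∈ M, (¬ ∃ c, ∀ x, f x = c) ∧ ¬ Function.Injective f) {C : Set Operation}
    (hC : C ∈ monoidalInterval M) : IsRichClone C := by
  have h : ∀ u ∈ M, unaryOperation u ∈ C := fun u hu => hC.2.symm.subset hu
  exact ⟨hC.1, fun σ => h _ (hperm σ), fun c => h _ (const_mem hM hperm hlarge c),
    fun p => h _ (pointIndicator_mem hM hperm hlarge p)⟩

/-- The side conditions record which unary operations `C` forces into `M`; they later bound the
index `m`. -/
theorem monoidalInterval_classification {M : Set (ℕ → ℕ)} (hM : IsLocalMonoid M)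
    (hperm : ∀ σ : Equiv.Perm ℕ, (⇑σ : ℕ → ℕ) ∈ M)
    (hlarge : ∃ f ∈ M, (¬ ∃ c, ∀ x, f x = c) ∧ ¬ Function.Injective f) {C : Set Operation}
    (hC : C ∈ monoidalInterval M) :
    (C = Set.univ ∧ ∀ k, ContainsRangeLe M k) ∨
      ∃ m, C = intervalChain M m ∧ (m ≠ 0 → ContainsRangeLe M 2 ∧ ContainsRangeLe M m) := by
  have hR := isRichClone_of_mem_monoidalInterval hM hperm hlarge hC
  have hunary : ∀ u, unaryOperation u ∈ C → u ∈ M := fun u hu => hC.2.subset hu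
  have hsub : cloneOf M ⊆ C := by
    rw [cloneOf_eq hM]
    exact essentiallyUnaryOver_subset hC.1.toIsClone fun u hu => hC.2.symm.subset hu
  have hEU : ∀ f ∈ C, EssentiallyUnary f.2 → f ∈ cloneOf M := by
    rintro ⟨n, f⟩ hf hu
    rw [cloneOf_eq hM]
    exact ⟨hu, hunary _ (hC.1.comp_mem n 1 f (fun _ x => x 0) hf fun _ => hC.1.proj_mem 1 0)⟩
  by_cases hall : ∀ f ∈ C, EssentiallyUnary f.2
  · exact Or.inr ⟨0, Set.Subset.antisymm (fun f hf => hEU f hf (hall f hf)) hsub, by simp⟩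
  push Not at hall
  obtain ⟨⟨n, f⟩, hf, hfu⟩ := hall
  have h2 : ContainsRangeLe M 2 := by
    intro h hh
    obtain ⟨a, b, hab⟩ := exists_two_values_of_encard_lt (hh.trans_lt (by norm_num))
    refine hunary h (hR.quasilinear_mem hf hfu ?_)
    exact EssentiallyUnary.quasilinear (n := 1)
      (essentiallyUnary_of_eq (h := h) (i := (0 : Fin 1)) fun _ => rfl) fun x => hab (x 0)
  by_cases hquasi : ∀ f ∈ C, ¬ EssentiallyUnary f.2 → Quasilinear f.2
  · refine Or.inr ⟨1, Set.Subset.antisymm (fun g hg => ?_) (Set.union_subset hsub fun g hg => ?_),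
      fun _ => ⟨h2, h2.mono (by norm_num)⟩⟩
    · by_cases hgu : EssentiallyUnary g.2
      · exact Or.inl (hEU g hg hgu)
      · exact Or.inr (hquasi g hg hgu)
    · exact hR.quasilinear_mem hf hfu hg
  push Not at hquasi
  obtain ⟨g, hg, hgu, hgq⟩ := hquasi
  set P : ℕ → Prop := fun k => ∃ f ∈ C, ¬ EssentiallyUnary f.2 ∧ ¬ Quasilinear f.2 ∧
    (k : ℕ∞) ≤ (Set.range f.2).encard
  have hPmem : ∀ k, 2 ≤ k → P k → ∀ (N : ℕ+) (h : Op N), (Set.range h).encard ≤ k →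
      (⟨N, h⟩ : Operation) ∈ C := by
    rintro k hk ⟨f, hf, hfu, hfq, hkf⟩ N
    exact hR.mem_of_encard_range_le hf hfu hfq hk hkf
  have hPM : ∀ k, 2 ≤ k → P k → ContainsRangeLe M k := by
    intro k hk hPk h hh
    exact hunary h (hPmem k hk hPk 1 (ofUnary h) ((congrArg Set.encard (range_ofUnary h)).trans_le hh))
  by_cases hunb : ∀ k, 2 ≤ k → P k
  · refine Or.inl ⟨hR.eq_univ_of_forall_encard_range_le fun N k h hh => ?_, fun k => ?_⟩
    · exact hPmem (max k 2) (le_max_right _ _) (hunb _ (le_max_right _ _)) N h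
        (hh.trans (by exact_mod_cast le_max_left k 2))
    · exact (hPM _ (le_max_right k 2) (hunb _ (le_max_right _ _))).mono (le_max_left _ _)
  -- `P 2` holds through `g`, so if `P` fails somewhere above, there is a place where it stops.
  · obtain ⟨m, hm, hm'⟩ : ∃ m, P (m + 2) ∧ ¬ P (m + 3) := by
      by_contra! hcon
      refine hunb fun k hk => ?_
      induction k, hk using Nat.le_induction with
      | base => exact ⟨g, hg, hgu, hgq, two_le_encard_range hgu⟩
      | succ k hk ih =>
        obtain ⟨l, rfl⟩ := Nat.exists_eq_add_of_le hk
        have := hcon l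
        rw [show 2 + l + 1 = l + 3 by omega]
        exact this (by rwa [show l + 2 = 2 + l by omega])
    refine Or.inr ⟨m + 2, Set.Subset.antisymm (fun f hf => ?_)
      (Set.union_subset hsub fun f hf => ?_), fun _ => ⟨h2, hPM _ (by omega) hm⟩⟩
    · by_cases hfu : EssentiallyUnary f.2
      · exact Or.inl (hEU f hf hfu)
      refine Or.inr ?_
      by_cases hfq : Quasilinear f.2
      · obtain ⟨a, b, hab⟩ := hfq.exists_two_values
        refine (encard_range_le_two hab).trans_lt ?_
        exact_mod_cast (by omega : 2 < m + 3)
      · by_contra hlt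
        exact hm' ⟨f, hf, hfu, hfq, not_lt.1 hlt⟩
    · have hf : (Set.range f.2).encard < ((m + 3 : ℕ) : ℕ∞) := hf
      exact hPmem (m + 2) (by omega) hm f.1 f.2
        ((ENat.lt_add_one_iff (by simp)).1 (hf.trans_eq (by push_cast; ring)))

theorem eq_univ_of_forall_containsRangeLe {M : Set (ℕ → ℕ)} (hM : IsLocalMonoid M)
    (h : ∀ k, ContainsRangeLe M k) : M = Set.univ := by
  classical
  refine Set.eq_univ_of_forall fun g => hM.isClosed.mem_of_forall_finset fun A => ?_
  refine ⟨fun x => if x ∈ A then g x else 0, h (insert 0 (A.image g)).card _ ?_,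
    fun x hx => by simp [hx]⟩
  rw [← Set.encard_coe_eq_coe_finsetCard]
  refine Set.encard_le_encard ?_
  rintro _ ⟨x, rfl⟩
  by_cases hx : x ∈ A
  · simp only [hx, if_true]
    exact_mod_cast Finset.mem_insert_of_mem (Finset.mem_image_of_mem g hx)
  · simp [hx]

/-- The constants give `k ≥ 1`. Without a bound, truncating maps outside finite sets and local
closure would put every map into `M`. -/
theorem exists_isGreatest_containsRangeLe {M : Set (ℕ → ℕ)} (hM : IsLocalMonoid M)
    (hperm : ∀ σ : Equiv.Perm ℕ, (⇑σ : ℕ → ℕ) ∈ M)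
    (hlarge : ∃ f ∈ M, (¬ ∃ c, ∀ x, f x = c) ∧ ¬ Function.Injective f) (hne : M ≠ Set.univ) :
    ∃ k, 1 ≤ k ∧ IsGreatest {j | ContainsRangeLe M j} k := by
  have h1 : ContainsRangeLe M 1 := by
    intro h hh
    have hh' : (Set.range h).encard ≤ 1 := by simpa using hh
    have : h = fun _ => h 0 :=
      funext fun x => Set.encard_le_one_iff.1 hh' _ _ ⟨x, rfl⟩ ⟨0, rfl⟩
    rw [this]
    exact const_mem hM hperm hlarge _
  have hbdd : BddAbove {j | ContainsRangeLe M j} := by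
    by_contra hb
    refine hne (eq_univ_of_forall_containsRangeLe hM fun k => ?_)
    obtain ⟨j, hj, hkj⟩ := not_bddAbove_iff.1 hb k
    exact ContainsRangeLe.mono hj hkj.le
  exact ⟨_, le_csSup hbdd h1, Nat.sSup_mem ⟨1, h1⟩ hbdd, fun _ => le_csSup hbdd⟩

theorem exists_orderIso_withTop {M : Set (ℕ → ℕ)} (hM : IsLocalMonoid M)
    (hperm : ∀ σ : Equiv.Perm ℕ, (⇑σ : ℕ → ℕ) ∈ M)
    (hlarge : ∃ f ∈ M, (¬ ∃ c, ∀ x, f x = c) ∧ ¬ Function.Injective f) (hMu : M = Set.univ) :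
    ∃ e : WithTop ℕ ≃o monoidalInterval M,
      (∀ n : ℕ, (e (n : WithTop ℕ) : Set Operation) = intervalChain M n) ∧
        (e ⊤ : Set Operation) = Set.univ := by
  have hk : ∀ k, ContainsRangeLe M k := fun k h _ => hMu ▸ Set.mem_univ h
  have htop : (Set.univ : Set Operation) ∈ monoidalInterval M :=
    ⟨⟨⟨fun _ _ => trivial, fun _ _ _ _ _ _ => trivial⟩, fun _ => isClosed_univ⟩, by simp [hMu]⟩
  have hmono := intervalChain_strictMono hM
  let g : WithTop ℕ → monoidalInterval M := fun a => a.recTopCoe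
    ⟨Set.univ, htop⟩ fun n => ⟨intervalChain M n, intervalChain_mem hM (hk 2) (hk n)⟩
  have hg : StrictMono g := by
    refine WithTop.strictMono_iff.2 ⟨fun a b hab => hmono hab, fun a => ?_⟩
    have h : intervalChain M a ⊂ Set.univ :=
      (hmono a.lt_succ_self).trans_le (Set.subset_univ _)
    exact h
  have hsurj : Function.Surjective g := by
    rintro ⟨C, hC⟩
    rcases monoidalInterval_classification hM hperm hlarge hC with ⟨rfl, -⟩ | ⟨m, rfl, -⟩
    · exact ⟨⊤, rfl⟩
    · exact ⟨(m : WithTop ℕ), rfl⟩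
  exact ⟨hg.orderIsoOfSurjective g hsurj, fun _ => rfl, rfl⟩

theorem exists_orderIso_fin {M : Set (ℕ → ℕ)} (hM : IsLocalMonoid M)
    (hperm : ∀ σ : Equiv.Perm ℕ, (⇑σ : ℕ → ℕ) ∈ M)
    (hlarge : ∃ f ∈ M, (¬ ∃ c, ∀ x, f x = c) ∧ ¬ Function.Injective f) {k : ℕ} (hk2 : 2 ≤ k)
    (hk : IsGreatest {j | ContainsRangeLe M j} k) :
    ∃ e : Fin (k + 1) ≃o monoidalInterval M, ∀ i, (e i : Set Operation) = intervalChain M i := by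
  let g : Fin (k + 1) → monoidalInterval M := fun i =>
    ⟨intervalChain M i, intervalChain_mem hM (hk.1.mono hk2) (hk.1.mono (Nat.lt_succ_iff.1 i.2))⟩
  have hg : StrictMono g := fun a b hab => intervalChain_strictMono hM hab
  have hsurj : Function.Surjective g := by
    rintro ⟨C, hC⟩
    rcases monoidalInterval_classification hM hperm hlarge hC with ⟨-, h⟩ | ⟨m, rfl, hm⟩
    -- The clone of all operations would require `M` to contain all maps with at most `k + 1`
    -- values.
    · exact absurd (hk.2 (h (k + 1))) (by omega)
    · refine ⟨⟨m, ?_⟩, rfl⟩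
      by_cases h0 : m = 0
      · omega
      · exact Nat.lt_succ_iff.2 (hk.2 (hm h0).2)
  exact ⟨hg.orderIsoOfSurjective g hsurj, fun _ => rfl⟩

theorem theorem8 (M : Set (ℕ → ℕ)) (hM : IsLocalMonoid M)
    (hperm : ∀ σ : Equiv.Perm ℕ, (⇑σ : ℕ → ℕ) ∈ M)
    (hlarge : ∃ f ∈ M, (¬ ∃ c, ∀ x, f x = c) ∧ ¬ Function.Injective f) :
    (M = Set.univ →
      cloneOf M = essentiallyUnaryOperations ∧
      ∃ e : WithTop ℕ ≃o monoidalInterval M,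
        (e ((0 : ℕ) : WithTop ℕ) : Set Operation) = cloneOf M ∧
        (e ((1 : ℕ) : WithTop ℕ) : Set Operation) = burleClone ∧
        (∀ n : ℕ, 3 ≤ n → (e ((n - 1 : ℕ) : WithTop ℕ) : Set Operation) = rangeClone n) ∧
        (e ⊤ : Set Operation) = Set.univ) ∧
    (M ≠ Set.univ →
      ∃ k : ℕ, 1 ≤ k ∧ IsGreatest {j : ℕ | ContainsRangeLe M j} k ∧
        (k = 1 → monoidalInterval M = {cloneOf M}) ∧
        (k ≠ 1 →
          ∃ e : Fin (k + 1) ≃o monoidalInterval M,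
            (e 0 : Set Operation) = cloneOf M ∧
            (e 1 : Set Operation) = burleCloneOver M ∧
            ∀ (n : ℕ) (_ : 3 ≤ n) (_ : n ≤ k + 1),
              (e ⟨n - 1, by omega⟩ : Set Operation) = rangeCloneOver M n)) := by
  refine ⟨fun hMu => ?_, fun hMu => ?_⟩
  · have hEU : cloneOf M = essentiallyUnaryOperations := by
      rw [cloneOf_eq hM]
      ext f
      simp [essentiallyUnaryOver, essentiallyUnaryOperations, hMu]
    obtain ⟨e, he, htop⟩ := exists_orderIso_withTop hM hperm hlarge hMu
    refine ⟨hEU, e, he 0, ?_, fun n hn => ?_, htop⟩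
    · rw [he 1, burleClone, ← hEU]
      rfl
    · rw [he, intervalChain_sub_one hn, rangeClone, ← hEU]
      rfl
  · obtain ⟨k, hk1, hk⟩ := exists_isGreatest_containsRangeLe hM hperm hlarge hMu
    refine ⟨k, hk1, hk, fun h1 => ?_, fun h1 => ?_⟩
    · refine Set.Subset.antisymm (fun C hC => ?_)
        (Set.singleton_subset_iff.2 (cloneOf_mem_monoidalInterval hM))
      rcases monoidalInterval_classification hM hperm hlarge hC with ⟨-, h⟩ | ⟨m, rfl, hm⟩
      · exact absurd (hk.2 (h (k + 1))) (by omega)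
      · by_cases h0 : m = 0
        · rw [h0]
          rfl
        -- Any index above `0` forces all two-valued maps into `M`, against `k = 1`.
        · exact absurd (hk.2 (hm h0).1) (by omega)
    · obtain ⟨e, he⟩ := exists_orderIso_fin hM hperm hlarge (by omega) hk
      refine ⟨e, he 0, ?_, fun n hn hnk => ?_⟩
      · rw [he, Fin.val_one', Nat.mod_eq_of_lt (by omega)]
        rfl
      · rw [he]
        exact intervalChain_sub_one hn
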